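/- **Setting.** Let $X$ be a connected metrizable topological space and let $F$ be a semi-flow on $X$, that is, a continuous map $(t,x)\mapsto F^t(x)$ with $F^0=\mathrm{id}$ and $F^{t_1+t_2}=F^{t_2}\circ F^{t_1}$, where either $t\in\{0,1,2,\dots\}$ (discrete time) or $t\in[0,\infty)$ (continuous time). A metric on $X$ is *compatible* if it induces the topology of $X$; $N_\delta(Q)$ is the $\delta$-neighbourhood of $Q$ for such a metric. Let $\Omega_F(x)$ be the set of limits of sequences $F^{t_n}(x)$ with $t_n\to\infty$. Assume that $F$ has *compact dynamics*: there is a compact set $Q$ with $F^t(Q)\subset Q$ for all $t\ge 0$ such that $\Omega_F(x)$ is a non-empty subset of $Q$ for every $x\in X$, and such that for some $\eta>0$ and all $\varepsilon,\delta\in(0,\eta)$ there is $t_0>0$ with $F^t(N_\delta(Q))\subset N_\varepsilon(Q)$ for all $t\ge t_0$ (for compact $Q$ this does not depend on the compatible metric). **Streams.** Let $\mathcal O_F=\{(x,F^t(x)):x\in X,\ t\ge0\}$. A *stream* of $F$ is a reflexive and transitive relation $S\subset X\times X$ that is closed in $X\times X$ and contains $\mathcal O_F$. *Auslander's stream* $\mathcal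 A_F$ is the smallest stream, i.e. the intersection of all streams. For a stream $S$, points $x,y$ are $S$-equivalent if $(x,y),(y,x)\in S$; a point $x$ is $S$-recurrent if it is fixed by all $F^t$ or is $S$-equivalent to some $y\ne x$. The *nodes* of $S$ are the classes of $S$-equivalence on the set of $S$-recurrent points. The *graph* of $S$ is the directed graph on the nodes of $S$ that has an edge from $N_1$ to $N_2\neq N_1$ if and only if $(x,y)\in S$ for all $x\in N_1$, $y\in N_2$. **Chains streams.** Let $d$ be a compatible metric. In discrete time, $(x,y)\in\mathcal C_{F,d}$ if and only if $(x,y)\in\mathcal O_F$ or, for every $\varepsilon>0$, there are $n\ge1$ and points $c_0=x,\dots,c_n=y$ with $d(F^1(c_i),c_{i+1})\le\varepsilon$ for all $i<n$; and $\Sigma_{F,d}$ is defined in the same way with the condition $\sum_{i<n}d(F^1(c_i),c_{i+1})<\varepsilon$ instead. In continuous time, $(x,y)\in\mathcal C_{F,d}$ if and only if $(x,y)\in\mathcal O_F$ or, for all $\varepsilon,T>0$, there are $n\ge1$, points $c_0=x,\dots,c_n=y$ and times $t_0,\dots,t_{n-1}\ge T$ with $d(F^{t_i}(c_i),c_{i+1})\le\varepsilon$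 for all $i<n$; and $\Sigma_{F,d}$ is defined in the same way with $\sum_{i<n}d(F^{t_i}(c_i),c_{i+1})<\varepsilon$ instead. **Theorem.** Let $F$ have compact dynamics, with $Q$ as above, and suppose that $\mathcal A_F$ has at most countably many nodes. Let $d$ be a compatible metric; in discrete time assume moreover that $F^1$ is uniformly continuous with respect to $d$ on some neighbourhood of $Q$ (this holds for every compatible $d$ if $Q$ has a compact neighbourhood, e.g. if $X$ is compact or locally compact). Then $$\mathcal A_F=\Sigma_{F,d}=\mathcal C_{F,d},$$ and every stream $S$ of $F$ with $\mathcal A_F\subset S\subset\mathcal C_{F,d}$ is equal to $\mathcal C_{F,d}$ and has the same nodes and the same graph as $\mathcal A_F$ and as $\mathcal C_{F,d}$. In particular $\mathcal C_{F,d}$ is the same relation $\mathcal C_F$ for all these metrics. Moreover, in discrete time and without any uniform continuity, $\mathcal A_F=\bigcap_d\mathcal C_{F,d}$, the intersection being over all compatible metrics $d$; so $\mathcal A_F=\mathcal C_F$ whenever $\mathcal C_{F,d}$ is the same relation $\mathcal C_F$ for all compatible metrics $d$. -/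

import Mathlib

open Set Filter Topology TopologicalSpace
open scoped NNReal

/-! Semi-flows on `X` are Mathlib's `Flow τ X`, jointly continuous actions of the monoid `τ`, with
`τ = ℕ` (discrete time) or `τ = ℝ≥0` (continuous time). Relations on `X` are subsets of `X × X`. -/

namespace ChainStreams

/-- `d` is a metric on the set `X` that induces the given topology of `X`. -/
structure IsCompatibleMetric {X : Type*} [TopologicalSpace X] (d : X → X → ℝ) : Prop where
  dist_self : ∀ x, d x x = 0
  eq_of_dist_eq_zero : ∀ x y, d x y = 0 → x = y
  symm : ∀ x y, d x y = d y x
  triangle : ∀ x y z, d x z ≤ d x y + d y z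
  isOpen_iff : ∀ s : Set X, IsOpen s ↔ ∀ x ∈ s, ∃ ε > 0, ∀ y, d x y < ε → y ∈ s

/-- The `δ`-neighbourhood `N_δ(Q)` with respect to `d`. -/
def nbhd {X : Type*} (d : X → X → ℝ) (δ : ℝ) (Q : Set X) : Set X :=
  {x | ∃ q ∈ Q, d x q < δ}

section Semiflow

variable {τ X : Type*} [AddMonoid τ] [TopologicalSpace τ] [TopologicalSpace X]

/-- The orbit space `O_F = {(x, F^t(x)) : t ≥ 0}`. -/
def orbitSpace (F : Flow τ X) : Set (X × X) :=
  {p | ∃ t : τ, F t p.1 = p.2}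

/-- Closed and forward-invariant. -/
def IsTrappingRegion (F : Flow τ X) (Q : Set X) : Prop :=
  IsClosed Q ∧ ∀ t : τ, MapsTo (F t) Q Q

/-- Every point has a non-empty limit set, contained in `Q`. -/
def IsGloballyAttracting [Preorder τ] (F : Flow τ X) (Q : Set X) : Prop :=
  ∀ x : X, (omegaLimit atTop F {x}).Nonempty ∧ omegaLimit atTop F {x} ⊆ Q

def IsUniformlyAsymptoticallyStable [Preorder τ] (F : Flow τ X) (d : X → X → ℝ) (Q : Set X) : Prop :=
  ∃ η : ℝ, 0 < η ∧ ∀ ε δ : ℝ, 0 < ε → ε < η → 0 < δ → δ < η →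
    ∃ t₀ : τ, 0 < t₀ ∧ ∀ t : τ, t₀ ≤ t → MapsTo (F t) (nbhd d δ Q) (nbhd d ε Q)

/-- A compact global trapping region. For compact `Q` the choice of the compatible metric in the
last clause does not matter. -/
structure IsCompactGlobalTrappingRegion [Preorder τ] (F : Flow τ X) (Q : Set X) : Prop where
  isCompact : IsCompact Q
  isTrappingRegion : IsTrappingRegion F Q
  isGloballyAttracting : IsGloballyAttracting F Q
  isUniformlyAsymptoticallyStable :
    ∃ d : X → X → ℝ, IsCompatibleMetric d ∧ IsUniformlyAsymptoticallyStable F d Q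

/-- A stream of `F`: a closed quasi-order on `X` that extends the orbit space. -/
structure IsStream (F : Flow τ X) (S : Set (X × X)) : Prop where
  refl : ∀ x, (x, x) ∈ S
  trans : ∀ x y z, (x, y) ∈ S → (y, z) ∈ S → (x, z) ∈ S
  isClosed : IsClosed S
  orbitSpace_subset : orbitSpace F ⊆ S

/-- Auslander's stream `A_F`, the smallest stream of `F`. -/
def auslanderStream (F : Flow τ X) : Set (X × X) :=
  ⋂₀ {S | IsStream F S}

theorem isStream_auslanderStream (F : Flow τ X) : IsStream F (auslanderStream F) where
  refl x := mem_sInter.2 fun _ hS => hS.refl x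
  trans x y z hxy hyz := mem_sInter.2 fun S hS =>
    hS.trans x y z (mem_sInter.1 hxy S hS) (mem_sInter.1 hyz S hS)
  isClosed := isClosed_sInter fun _ hS => hS.isClosed
  orbitSpace_subset := subset_sInter fun _ hS => hS.orbitSpace_subset

theorem auslanderStream_subset (F : Flow τ X) {S : Set (X × X)} (hS : IsStream F S) :
    auslanderStream F ⊆ S :=
  sInter_subset_of_mem hS

/-- `S`-equivalence of `x` and `y`. -/
def StreamEquiv (S : Set (X × X)) (x y : X) : Prop :=
  (x, y) ∈ S ∧ (y, x) ∈ S

/-- The set `R_S` of `S`-recurrent points: the fixed points of `F` and the points that are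
`S`-equivalent to some other point. -/
def recurrentSet (F : Flow τ X) (S : Set (X × X)) : Set X :=
  {x | (∀ t : τ, F t x = x) ∨ ∃ y, y ≠ x ∧ StreamEquiv S x y}

/-- The nodes of `S`: the classes of `S`-equivalence on `R_S`. -/
def nodes (F : Flow τ X) (S : Set (X × X)) : Set (Set X) :=
  {N | ∃ x ∈ recurrentSet F S, N = {y | y ∈ recurrentSet F S ∧ StreamEquiv S x y}}

/-- The edges of the graph `Γ_S`, whose vertices are the nodes of `S`. -/
def edges (F : Flow τ X) (S : Set (X × X)) : Set (Set X × Set X) :=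
  {e | e.1 ∈ nodes F S ∧ e.2 ∈ nodes F S ∧ e.1 ≠ e.2 ∧ ∀ x ∈ e.1, ∀ y ∈ e.2, (x, y) ∈ S}

end Semiflow

section Discrete

variable {X : Type*} [TopologicalSpace X]

/-- There is an `ε`-chain `c 0, …, c n` from `x` to `y`. -/
def HasChain (F : Flow ℕ X) (d : X → X → ℝ) (ε : ℝ) (x y : X) : Prop :=
  ∃ (n : ℕ) (c : ℕ → X), 0 < n ∧ c 0 = x ∧ c n = y ∧ ∀ i < n, d (F 1 (c i)) (c (i + 1)) ≤ ε

/-- There is an `ε`-`Σ`-chain `c 0, …, c n` from `x` to `y`. -/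
def HasSumChain (F : Flow ℕ X) (d : X → X → ℝ) (ε : ℝ) (x y : X) : Prop :=
  ∃ (n : ℕ) (c : ℕ → X), 0 < n ∧ c 0 = x ∧ c n = y ∧
    ∑ i ∈ Finset.range n, d (F 1 (c i)) (c (i + 1)) < ε

/-- The chains stream `C_{F,d}` in discrete time. -/
def chainsStream (F : Flow ℕ X) (d : X → X → ℝ) : Set (X × X) :=
  {p | ∀ ε : ℝ, 0 < ε → p ∈ orbitSpace F ∨ HasChain F d ε p.1 p.2}

/-- The summable chains stream `Σ_{F,d}` in discrete time. -/
def sumChainsStream (F : Flow ℕ X) (d : X → X → ℝ) : Set (X × X) :=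
  {p | ∀ ε : ℝ, 0 < ε → p ∈ orbitSpace F ∨ HasSumChain F d ε p.1 p.2}

/-- `f` is uniformly continuous with respect to `d` on some neighbourhood of `Q`. -/
def UniformlyContinuousNear (d : X → X → ℝ) (f : X → X) (Q : Set X) : Prop :=
  ∃ U ∈ 𝓝ˢ Q, ∀ ε > 0, ∃ δ > 0, ∀ x ∈ U, ∀ y ∈ U, d x y < δ → d (f x) (f y) < ε

end Discrete

section Continuous

variable {X : Type*} [TopologicalSpace X]

/-- There is an `(ε, T)`-chain `c 0, …, c n` from `x` to `y` with times `t 0, …, t (n - 1) ≥ T`. -/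
def HasTimedChain (F : Flow ℝ≥0 X) (d : X → X → ℝ) (ε : ℝ) (T : ℝ≥0) (x y : X) : Prop :=
  ∃ (n : ℕ) (c : ℕ → X) (t : ℕ → ℝ≥0), 0 < n ∧ c 0 = x ∧ c n = y ∧
    ∀ i < n, T ≤ t i ∧ d (F (t i) (c i)) (c (i + 1)) ≤ ε

/-- There is an `(ε, T)`-`Σ`-chain from `x` to `y`: all times are at least `T`, and the jumps add
up to less than `ε`. -/
def HasTimedSumChain (F : Flow ℝ≥0 X) (d : X → X → ℝ) (ε : ℝ) (T : ℝ≥0) (x y : X) : Prop :=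
  ∃ (n : ℕ) (c : ℕ → X) (t : ℕ → ℝ≥0), 0 < n ∧ c 0 = x ∧ c n = y ∧ (∀ i < n, T ≤ t i) ∧
    ∑ i ∈ Finset.range n, d (F (t i) (c i)) (c (i + 1)) < ε

/-- The chains stream `C_{F,d}` in continuous time. -/
def timedChainsStream (F : Flow ℝ≥0 X) (d : X → X → ℝ) : Set (X × X) :=
  {p | ∀ T : ℝ≥0, 0 < T → ∀ ε : ℝ, 0 < ε → p ∈ orbitSpace F ∨ HasTimedChain F d ε T p.1 p.2}

/-- The summable chains stream `Σ_{F,d}` in continuous time. -/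
def timedSumChainsStream (F : Flow ℝ≥0 X) (d : X → X → ℝ) : Set (X × X) :=
  {p | ∀ T : ℝ≥0, 0 < T → ∀ ε : ℝ, 0 < ε → p ∈ orbitSpace F ∨ HasTimedSumChain F d ε T p.1 p.2}

end Continuous

end ChainStreams

open ChainStreams

/-!
Let `A` be Auslander's stream and `C` a chains stream. The inclusions `A ⊆ Σ ⊆ C` hold for every
compatible metric, because summable chains form a stream: their end points can be moved at the cost
of an arbitrarily small jump (`isStream_forall_sumChain`, `isStream_orbitSpace_union_sumChain`).

For `C ⊆ A` let `(x, y) ∈ C`. Unless `y` lies on the orbit of `x`, chains with small jumps from `x`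
to `y` follow the orbit of `x` until they are close to some `p` in the limit set of `x`, and from
then on they stay close to the compact set `Q`. As `(x, p) ∈ A`, it suffices that `(p, y) ∈ A`, and
this holds for the following reason (`mem_of_chains_near`). Otherwise, Nachbin's theorem for the
closed quasi-order that `A` induces on `Q` yields a continuous function `L` on `Q` that decreases
along `A`, strictly except between equivalent points, with `L p < L y`
(`exists_continuous_strictAnti_separating`). It is constant on nodes, so that it takes only
countably many values on recurrent points, and there is a level `c` between `L p` and `L y` that is
not among these. At a point of `Q` with value `c` the function `L` strictly decreases along the
semi-flow. By compactness, chains near `Q` with small jumps cannot leave `{L < c}`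
(`exists_barrier`), whereas they lead from points near `p` to `y`.

In continuous time chains stay near `Q` because all their steps are long. In discrete time this
needs the uniform continuity of `F 1` near `Q`, by which short chains with small jumps follow orbits
(`IsCompactGlobalTrappingRegion.exists_forall_chain_mem_thickening`). Since some compatible metric
makes `F 1` Lipschitz (`exists_isCompatibleMetric_lipschitz`), `A` is the intersection of all the
chains streams also without this hypothesis.
-/

namespace ChainStreams

/-! ### Lyapunov functions of closed quasi-orders on compact spaces -/

section ClosedQuasiOrder

variable {K : Type*} [TopologicalSpace K] [CompactSpace K] {R : Set (K × K)}

theorem isClosed_setOf_exists_mem_above (hR : IsClosed R) {C : Set K} (hC : IsClosed C) :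
    IsClosed {x | ∃ k ∈ C, (x, k) ∈ R} := by
  have h : IsClosed (R ∩ Prod.snd ⁻¹' C) := hR.inter (hC.preimage continuous_snd)
  convert isClosedMap_fst_of_compactSpace _ h using 1
  ext x
  simp only [mem_ofPred_eq, mem_image, mem_inter_iff, mem_preimage, Prod.exists,
    exists_and_right, exists_eq_right]
  exact ⟨fun ⟨k, hk, h⟩ => ⟨k, h, hk⟩, fun ⟨k, h, hk⟩ => ⟨k, hk, h⟩⟩

theorem isClosed_setOf_exists_mem_below (hR : IsClosed R) {C : Set K} (hC : IsClosed C) :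
    IsClosed {x | ∃ k ∈ C, (k, x) ∈ R} :=
  isClosed_setOf_exists_mem_above (R := Prod.swap ⁻¹' R) (hR.preimage continuous_swap) hC

variable [T2Space K]

/-- Nachbin's order-preserving Urysohn lemma for a pair of points: in Urysohn's construction all
intermediate open sets are chosen to be closed under passing from `x` to `y` for `(x, y) ∈ R`. -/
theorem exists_continuous_antitone_separating (hR : IsClosed R) (hrefl : ∀ x, (x, x) ∈ R)
    (htrans : ∀ x y z, (x, y) ∈ R → (y, z) ∈ R → (x, z) ∈ R) {p q : K} (hpq : (p, q) ∉ R) :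
    ∃ L : K → ℝ, Continuous L ∧ (∀ x, L x ∈ Icc (0 : ℝ) 1) ∧
      (∀ x y, (x, y) ∈ R → L y ≤ L x) ∧ L p = 0 ∧ L q = 1 := by
  let P : Set K → Set K → Prop := fun _ u => ∀ x y, (x, y) ∈ R → x ∈ u → y ∈ u
  let c : Urysohns.CU P :=
    { C := {p}
      U := {z | (z, q) ∉ R}
      P_C_U := fun x z hxz hx hz => hx (htrans _ _ _ hxz hz)
      closed_C := isClosed_singleton
      open_U := by
        have : IsClosed {z | (z, q) ∈ R} := hR.preimage (by fun_prop)
        exact this.isOpen_compl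
      subset := by simpa using hpq
      hP := by
        intro c u hc hu hou hcu
        have hlow : IsClosed {x | ∃ k ∈ c, (k, x) ∈ R} := isClosed_setOf_exists_mem_below hR hc
        obtain ⟨w, hwo, hw, hwu⟩ := normal_exists_closure_subset hlow hou
          (by rintro x ⟨k, hk, hkx⟩; exact hu k x hkx (hcu hk))
        have hup : IsClosed {x | ∃ k ∈ wᶜ, (x, k) ∈ R} :=
          isClosed_setOf_exists_mem_above hR hwo.isClosed_compl
        have hvw : {x | ∃ k ∈ wᶜ, (x, k) ∈ R}ᶜ ⊆ w := fun x hx => by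
          by_contra hxw
          exact hx ⟨x, hxw, hrefl x⟩
        refine ⟨{x | ∃ k ∈ wᶜ, (x, k) ∈ R}ᶜ, hup.isOpen_compl, ?_,
          (closure_mono hvw).trans hwu, ?_, hu⟩
        · rintro x hx ⟨k, hk, hxk⟩
          exact hk (hw ⟨x, hx, hxk⟩)
        · rintro x y hxy hx ⟨k, hk, hyk⟩
          exact hx ⟨k, hk, htrans _ _ _ hxy hyk⟩ }
  have happrox : ∀ (n : ℕ) (c : Urysohns.CU P) (x y : K), (x, y) ∈ R →
      c.approx n y ≤ c.approx n x := by
    intro n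
    induction n with
    | zero =>
      intro c x y hxy
      by_cases hx : x ∈ c.U
      · have hy : y ∈ c.U := c.P_C_U x y hxy hx
        simp [Urysohns.CU.approx, hx, hy]
      · rw [c.approx_of_notMem_U 0 hx]
        exact c.approx_le_one 0 y
    | succ n ih =>
      intro c x y hxy
      exact midpoint_le_midpoint (ih _ _ _ hxy) (ih _ _ _ hxy)
  exact ⟨c.lim, c.continuous_lim, c.lim_mem_Icc,
    fun x y hxy => le_of_tendsto_of_tendsto' (c.tendsto_approx_atTop y) (c.tendsto_approx_atTop x)
      fun n => happrox n c x y hxy,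
    c.lim_of_mem_C p rfl, c.lim_of_notMem_U q fun h => h (hrefl q)⟩

/-- The strict version: countably many separating functions suffice for all pairs outside `R`,
by second countability, and a convergent weighted sum of them is strictly monotone. -/
theorem exists_continuous_strictAnti_separating [SecondCountableTopology K]
    (hR : IsClosed R) (hrefl : ∀ x, (x, x) ∈ R)
    (htrans : ∀ x y z, (x, y) ∈ R → (y, z) ∈ R → (x, z) ∈ R) {p q : K} (hpq : (p, q) ∉ R) :
    ∃ L : K → ℝ, Continuous L ∧ (∀ x y, (x, y) ∈ R → L y ≤ L x) ∧
      (∀ x y, (x, y) ∈ R → (y, x) ∉ R → L y < L x) ∧ L p < L q := by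
  choose L hLc hLI hLm hL0 hL1 using fun e : {e : K × K // e ∉ R} =>
    exists_continuous_antitone_separating hR hrefl htrans (p := e.1.1) (q := e.1.2) e.2
  let O : {e : K × K // e ∉ R} → Set (K × K) := fun e => {z | L e z.1 < L e z.2}
  have hO : ∀ e, IsOpen (O e) := fun e =>
    isOpen_lt ((hLc e).comp continuous_fst) ((hLc e).comp continuous_snd)
  obtain ⟨T, hTc, hT⟩ := isOpen_iUnion_countable O hO
  have hTne : T.Nonempty := by
    have h : (p, q) ∈ ⋃ e, O e := mem_iUnion.2 ⟨⟨(p, q), hpq⟩, by simp [O, hL0, hL1]⟩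
    rw [← hT] at h
    obtain ⟨e, he, -⟩ := mem_iUnion₂.1 h
    exact ⟨e, he⟩
  obtain ⟨f, rfl⟩ := hTc.exists_eq_range hTne
  let e₀ : {e : K × K // e ∉ R} := ⟨(p, q), hpq⟩
  let M : K → ℝ := fun x => ∑' n, (1 / 2 : ℝ) ^ n * L (f n) x
  have hterm : ∀ n x, (1 / 2 : ℝ) ^ n * L (f n) x ∈ Icc (0 : ℝ) ((1 / 2 : ℝ) ^ n) := fun n x =>
    ⟨mul_nonneg (by positivity) (hLI _ x).1, mul_le_of_le_one_right (by positivity) (hLI _ x).2⟩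
  have hgeom : Summable fun n : ℕ => (1 / 2 : ℝ) ^ n := summable_geometric_two
  have hsum : ∀ x, Summable fun n => (1 / 2 : ℝ) ^ n * L (f n) x := fun x =>
    hgeom.of_nonneg_of_le (fun n => (hterm n x).1) fun n => (hterm n x).2
  have hMc : Continuous M :=
    continuous_tsum (fun n => (hLc (f n)).const_mul _) hgeom fun n x => by
      rw [Real.norm_of_nonneg (hterm n x).1]
      exact (hterm n x).2
  have hM0 : ∀ x, 0 ≤ M x := fun x => tsum_nonneg fun n => (hterm n x).1
  have hM2 : ∀ x, M x ≤ 2 := fun x =>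
    ((hsum x).tsum_le_tsum (fun n => (hterm n x).2) hgeom).trans tsum_geometric_two.le
  have hMm : ∀ x y, (x, y) ∈ R → M y ≤ M x := fun x y hxy =>
    (hsum y).tsum_le_tsum (fun n => by have := hLm (f n) x y hxy; gcongr) (hsum x)
  -- The factor `3` lets the function separating `p` from `q` outweigh `M`, whose values are at
  -- most `2`.
  refine ⟨fun x => 3 * L e₀ x + M x, by have := hLc e₀; fun_prop, ?_, ?_, ?_⟩
  · intro x y hxy
    have := hLm e₀ x y hxy
    have := hMm x y hxy
    dsimp only
    linarith
  · intro x y hxy hyx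
    have h : (y, x) ∈ ⋃ e, O e := mem_iUnion.2 ⟨⟨(y, x), hyx⟩, by simp [O, hL0, hL1]⟩
    rw [← hT] at h
    obtain ⟨e, ⟨n, rfl⟩, he⟩ := mem_iUnion₂.1 h
    have hlt : M y < M x := Summable.tsum_lt_tsum (i := n)
      (fun k => by have := hLm (f k) x y hxy; gcongr)
      (by have : L (f n) y < L (f n) x := he
          gcongr) (hsum y) (hsum x)
    have := hLm e₀ x y hxy
    dsimp only
    linarith
  · have h0 : L e₀ p = 0 := hL0 e₀
    have h1 : L e₀ q = 1 := hL1 e₀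
    have := hM2 p
    have := hM0 q
    dsimp only
    linarith

end ClosedQuasiOrder

/-! ### Compatible metrics -/

section Compatible

variable {X : Type*}

theorem IsCompatibleMetric.exists_metricSpace [t : TopologicalSpace X] {d : X → X → ℝ}
    (hd : IsCompatibleMetric d) :
    ∃ m : MetricSpace X, m.toPseudoMetricSpace.toUniformSpace.toTopologicalSpace = t ∧
      d = fun x y => m.dist x y := by
  let m : MetricSpace X :=
    { dist := d
      dist_self := hd.dist_self
      dist_comm := hd.symm
      dist_triangle := hd.triangle
      eq_of_dist_eq_zero := fun {x y} h => hd.eq_of_dist_eq_zero x y h }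
  refine ⟨m, ?_, rfl⟩
  ext s
  rw [hd.isOpen_iff, Metric.isOpen_iff]
  refine forall₂_congr fun x _ => exists_congr fun ε => and_congr_right fun _ => ?_
  refine forall_congr' fun y => ?_
  rw [Metric.mem_ball, dist_comm]
  rfl

theorem nbhd_dist [MetricSpace X] (δ : ℝ) (Q : Set X) :
    nbhd (fun x y : X => dist x y) δ Q = Metric.thickening δ Q := by
  ext x
  exact Metric.mem_thickening_iff.symm

end Compatible

section Semiflow

variable {τ X : Type*} [AddMonoid τ] [TopologicalSpace τ]

/-- A formulation of uniform asymptotic stability that does not mention a metric. -/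
theorem IsCompactGlobalTrappingRegion.exists_nhdsSet_mapsTo [Preorder τ] [TopologicalSpace X]
    {F : Flow τ X} {Q : Set X} (hQ : IsCompactGlobalTrappingRegion F Q) :
    ∃ W ∈ 𝓝ˢ Q, ∀ V ∈ 𝓝ˢ Q, ∃ t₀ : τ, ∀ t, t₀ ≤ t → MapsTo (F t) W V := by
  obtain ⟨d, hd, η, hη, h⟩ := hQ.isUniformlyAsymptoticallyStable
  have hcomp := hQ.isCompact
  obtain ⟨m, rfl, rfl⟩ := hd.exists_metricSpace
  have hb := Metric.hasBasis_nhdsSet_thickening hcomp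
  refine ⟨Metric.thickening (η / 2) Q, hb.mem_of_mem (half_pos hη), fun V hV => ?_⟩
  obtain ⟨ε, hε, hεV⟩ := hb.mem_iff.1 hV
  obtain ⟨t₀, -, ht₀⟩ := h (min ε (η / 2)) (η / 2) (lt_min hε (half_pos hη))
    ((min_le_right _ _).trans_lt (half_lt_self hη)) (half_pos hη) (half_lt_self hη)
  refine ⟨t₀, fun t ht x hx => hεV (Metric.thickening_mono (min_le_left ε (η / 2)) _ ?_)⟩
  have := ht₀ t ht
  rw [nbhd_dist, nbhd_dist] at this
  exact this hx

/-! ### Recurrence and the level sets of Lyapunov functions -/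

variable [TopologicalSpace X]

/-- Every element of `τ` is at most a multiple of `u`, in the algebraic preorder of `τ`. -/
def IsArchimedeanUnit (u : τ) : Prop := ∀ s : τ, ∃ (n : ℕ) (r : τ), r + s = n • u

/-- A point is recurrent as soon as one of its later positions leads back to it. -/
theorem IsStream.mem_recurrentSet_of_return {F : Flow τ X} {S : Set (X × X)} (hS : IsStream F S)
    {u : τ} (hu : IsArchimedeanUnit u) {p : X} (h : (F u p, p) ∈ S) : p ∈ recurrentSet F S := by
  have horb : ∀ (t : τ) (x : X), (x, F t x) ∈ S := fun t x => hS.orbitSpace_subset ⟨t, rfl⟩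
  by_contra hp
  have key : ∀ t, (F t p, p) ∈ S → F t p = p := fun t ht => by
    by_contra hne
    exact hp (Or.inr ⟨F t p, hne, horb t p, ht⟩)
  have hfix : F u p = p := key u h
  have hn : ∀ n : ℕ, F (n • u) p = p := by
    intro n
    induction n with
    | zero => rw [zero_smul, F.map_zero_apply]
    | succ n ih => rw [succ_nsmul, F.map_add, hfix, ih]
  refine hp (Or.inl fun s => key s ?_)
  obtain ⟨n, r, hr⟩ := hu s
  have h' := horb r (F s p)
  rwa [← F.map_add, hr, hn] at h'

/-- A function that decreases along the stream is constant on nodes. -/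
theorem countable_image_recurrentSet_inter {F : Flow τ X} {S : Set (X × X)}
    (hS : IsStream F S) (hnodes : (nodes F S).Countable) {Q : Set X} {L : X → ℝ}
    (hL : ∀ x ∈ Q, ∀ y ∈ Q, (x, y) ∈ S → L y ≤ L x) :
    (L '' (recurrentSet F S ∩ Q)).Countable := by
  have h : L '' (recurrentSet F S ∩ Q) ⊆ ⋃ N ∈ nodes F S, L '' (N ∩ Q) := by
    rintro _ ⟨x, ⟨hx, hxQ⟩, rfl⟩
    exact mem_biUnion (x := {y | y ∈ recurrentSet F S ∧ StreamEquiv S x y}) ⟨x, hx, rfl⟩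
      ⟨x, ⟨⟨hx, hS.refl x, hS.refl x⟩, hxQ⟩, rfl⟩
  refine (hnodes.biUnion fun N hN => Set.Subsingleton.countable ?_).mono h
  obtain ⟨x, hx, rfl⟩ := hN
  rintro _ ⟨y, ⟨⟨-, hxy, hyx⟩, hyQ⟩, rfl⟩ _ ⟨z, ⟨⟨-, hxz, hzx⟩, hzQ⟩, rfl⟩
  exact le_antisymm (hL z hzQ y hyQ (hS.trans _ _ _ hzx hxy))
    (hL y hyQ z hzQ (hS.trans _ _ _ hyx hxz))

theorem IsStream.mem_of_mem_omegaLimit [Preorder τ] [(atTop : Filter τ).NeBot] {F : Flow τ X}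
    {S : Set (X × X)} (hS : IsStream F S) {x p : X} (hp : p ∈ omegaLimit atTop F {x}) :
    (x, p) ∈ S := by
  have hcl : IsClosed {z | (x, z) ∈ S} := hS.isClosed.preimage (by fun_prop)
  rw [mem_omegaLimit_singleton_iff_mapClusterPt] at hp
  exact hcl.mem_of_mapClusterPt hp
    (Eventually.of_forall fun t => hS.orbitSpace_subset ⟨t, rfl⟩)

end Semiflow

/-! ### Barriers for chains near a compact set -/

section Barrier

variable {τ X : Type*} [AddMonoid τ] [TopologicalSpace τ] [MetricSpace X]

/-- A point `y` with `(p, y) ∉ S` is separated from `p` by a strict sublevel set of a Lyapunov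
function, with the level chosen off the countable set of values on recurrent points. Near `Q`, an
orbit segment of length at least `u`, followed by a small jump, does not lead out of that set. -/
theorem exists_barrier {F : Flow τ X} {S : Set (X × X)} (hS : IsStream F S)
    (hnodes : (nodes F S).Countable) {u : τ} (hu : IsArchimedeanUnit u) {Q : Set X}
    (hQ : IsCompact Q) {p y : X} (hp : p ∈ Q) (hy : y ∈ Q) (hpy : (p, y) ∉ S) :
    ∃ U : Set X, IsOpen U ∧ p ∈ U ∧ y ∉ U ∧ ∃ δ > 0, ∀ a ∈ Metric.thickening δ Q,
      ∀ b ∈ Metric.thickening δ Q, ∀ s : τ, dist (F (s + u) a) b < δ → a ∈ U → b ∈ U := by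
  have horb : ∀ (t : τ) (x : X), (x, F t x) ∈ S := fun t x => hS.orbitSpace_subset ⟨t, rfl⟩
  have : CompactSpace Q := isCompact_iff_compactSpace.1 hQ
  have hRc : IsClosed {e : Q × Q | ((e.1 : X), (e.2 : X)) ∈ S} :=
    hS.isClosed.preimage (by fun_prop)
  obtain ⟨L₀, hL₀c, hL₀m, hL₀s, hL₀⟩ := exists_continuous_strictAnti_separating hRc
    (fun x => hS.refl x) (fun x y z => hS.trans x y z) (p := ⟨p, hp⟩) (q := ⟨y, hy⟩) hpy
  obtain ⟨L, hL⟩ := ContinuousMap.exists_restrict_eq hQ.isClosed (⟨L₀, hL₀c⟩ : C(Q, ℝ))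
  have hLQ : ∀ x (hx : x ∈ Q), L x = L₀ ⟨x, hx⟩ := fun x hx => DFunLike.congr_fun hL ⟨x, hx⟩
  have hLm : ∀ x ∈ Q, ∀ y ∈ Q, (x, y) ∈ S → L y ≤ L x := fun x hx y hy h => by
    rw [hLQ x hx, hLQ y hy]
    exact hL₀m _ _ h
  have hLs : ∀ x ∈ Q, ∀ y ∈ Q, (x, y) ∈ S → L y = L x → (y, x) ∈ S := fun x hx y hy h he => by
    by_contra h'
    have := hL₀s ⟨x, hx⟩ ⟨y, hy⟩ h h'
    rw [← hLQ x hx, ← hLQ y hy] at this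
    exact this.ne he
  have hLpy : L p < L y := by rwa [hLQ p hp, hLQ y hy]
  obtain ⟨c, hc, hpc, hcy⟩ := ((countable_image_recurrentSet_inter hS hnodes
    hLm).dense_compl ℝ).exists_between hLpy
  refine ⟨L ⁻¹' Iio c, isOpen_Iio.preimage L.continuous, hpc, not_lt.2 hcy.le, ?_⟩
  by_contra! hcon
  have hpos : ∀ n : ℕ, (0 : ℝ) < 1 / ((n : ℝ) + 1) := fun n => Nat.one_div_pos_of_nat
  choose a ha b hb s hab haU hbU using fun n : ℕ => hcon (1 / ((n : ℝ) + 1)) (hpos n)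
  choose a' ha'Q ha' using fun n => Metric.mem_thickening_iff.1 (ha n)
  choose b' hb'Q hb' using fun n => Metric.mem_thickening_iff.1 (hb n)
  obtain ⟨⟨q, r⟩, ⟨hq, hr⟩, φ, hφ, hlim⟩ := (hQ.prod hQ).tendsto_subseq
    (x := fun n => (a' n, b' n)) fun n => ⟨ha'Q n, hb'Q n⟩
  have hz : Tendsto (fun n => 1 / ((φ n : ℝ) + 1)) atTop (𝓝 0) :=
    tendsto_one_div_add_atTop_nhds_zero_nat.comp hφ.tendsto_atTop
  have hsq : ∀ {f g : ℕ → X} {z : X}, (∀ n, dist (f n) (g n) < 1 / ((n : ℝ) + 1)) →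
      Tendsto (g ∘ φ) atTop (𝓝 z) → Tendsto (f ∘ φ) atTop (𝓝 z) := fun hfg hg =>
    (tendsto_iff_of_dist (squeeze_zero (fun _ => dist_nonneg) (fun n => (hfg (φ n)).le) hz)).2 hg
  have hta : Tendsto (a ∘ φ) atTop (𝓝 q) := hsq ha' hlim.fst_nhds
  have htb : Tendsto (b ∘ φ) atTop (𝓝 r) := hsq hb' hlim.snd_nhds
  have htF : Tendsto ((fun n => F (s n + u) (a n)) ∘ φ) atTop (𝓝 r) := hsq hab htb
  have htu : Tendsto (fun n => F u (a (φ n))) atTop (𝓝 (F u q)) :=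
    ((F.continuous continuous_const continuous_id).tendsto q).comp hta
  -- In the limit the orbit segment from `F u q` onwards becomes a pair of the stream.
  have hqr : (F u q, r) ∈ S :=
    hS.isClosed.mem_of_tendsto (htu.prodMk_nhds htF) (Eventually.of_forall fun n => by
      have := horb (s (φ n)) (F u (a (φ n)))
      rwa [← F.map_add] at this)
  have hFr : (q, r) ∈ S := hS.trans _ _ _ (horb u q) hqr
  have h1 : L q ≤ c := le_of_tendsto ((L.continuous.tendsto q).comp hta)
    (Eventually.of_forall fun n => (haU (φ n)).le)
  have h2 : c ≤ L r := ge_of_tendsto ((L.continuous.tendsto r).comp htb)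
    (Eventually.of_forall fun n => not_lt.1 (hbU (φ n)))
  have h3 := hLm q hq r hr hFr
  have hrq : (r, q) ∈ S := hLs q hq r hr hFr (by linarith)
  exact hc ⟨q, ⟨hS.mem_recurrentSet_of_return hu (hS.trans _ _ _ hqr hrq), hq⟩, by linarith⟩

/-- If chains with arbitrarily small jumps lead to `y` from points near `p` and stay near `Q`, then
`(p, y)` belongs to the stream. -/
theorem mem_of_chains_near {F : Flow τ X} {S : Set (X × X)} (hS : IsStream F S)
    (hnodes : (nodes F S).Countable) {u : τ} (hu : IsArchimedeanUnit u) {Q : Set X}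
    (hQ : IsCompact Q) {p y : X} (hp : p ∈ Q)
    (h : ∀ r > 0, ∀ U : Set X, IsOpen U → p ∈ U → ∃ (n : ℕ) (c : ℕ → X) (s : ℕ → τ),
      c 0 ∈ U ∧ c n = y ∧ (∀ i ≤ n, c i ∈ Metric.thickening r Q) ∧
      ∀ i < n, dist (F (s i + u) (c i)) (c (i + 1)) < r) : (p, y) ∈ S := by
  have hy : y ∈ Q := by
    rw [← hQ.isClosed.closure_eq, Metric.closure_eq_iInter_thickening]
    refine mem_iInter₂.2 fun r hr => ?_
    obtain ⟨n, c, -, -, hn, hc, -⟩ := h r hr univ isOpen_univ (mem_univ p)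
    exact hn ▸ hc n le_rfl
  by_contra hpy
  obtain ⟨U, hUo, hpU, hyU, δ, hδ, hbar⟩ := exists_barrier hS hnodes hu hQ hp hy hpy
  obtain ⟨n, c, s, hc0, hn, hc, hs⟩ := h δ hδ U hUo hpU
  have hall : ∀ i ≤ n, c i ∈ U := by
    intro i
    induction i with
    | zero => exact fun _ => hc0
    | succ i ih =>
      exact fun hi => hbar _ (hc i (by lia)) _ (hc (i + 1) hi) (s i) (hs i hi) (ih (by lia))
  exact hyU (hn ▸ hall n le_rfl)

end Barrier

/-! ### Summable chains form a stream -/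

section SumChain

variable {τ X : Type*} [AddMonoid τ] [TopologicalSpace τ] [MetricSpace X]

/-- `SumChain F A e x y`: there is a chain from `x` to `y` whose steps follow the flow for times in
`A` and whose jumps add up to at most `e`. -/
inductive SumChain (F : Flow τ X) (A : Set τ) : ℝ → X → X → Prop
  | single {e : ℝ} {x y : X} (t : τ) (ht : t ∈ A) (h : dist (F t x) y ≤ e) : SumChain F A e x y
  | cons {a b e : ℝ} {x z y : X} (t : τ) (ht : t ∈ A) (ha : dist (F t x) z ≤ a)
      (hc : SumChain F A b z y) (h : a + b ≤ e) : SumChain F A e x y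

namespace SumChain

variable {F : Flow τ X} {A B : Set τ} {a b e e' r : ℝ} {x x' y y' z : X}

theorem mono (h : SumChain F A e x y) (he : e ≤ e') : SumChain F A e' x y := by
  cases h with
  | single t ht h => exact .single t ht (h.trans he)
  | cons t ht ha hc h => exact .cons t ht ha hc (h.trans he)

theorem mono_times (h : SumChain F A e x y) (hAB : A ⊆ B) : SumChain F B e x y := by
  induction h with
  | single t ht h => exact .single t (hAB ht) h
  | cons t ht ha _ h ih => exact .cons t (hAB ht) ha ih h

theorem trans (h : SumChain F A a x y) (h' : SumChain F A b y z) :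
    SumChain F A (a + b) x z := by
  induction h with
  | single t ht h => exact .cons t ht h h' le_rfl
  | cons t ht ha _ h ih => exact .cons t ht ha (ih h') (by linarith)

theorem move_end (h : SumChain F A e x y) (hy : dist y y' ≤ r) :
    SumChain F A (e + r) x y' := by
  induction h with
  | single t ht h => exact .single t ht ((dist_triangle _ _ _).trans (add_le_add h hy))
  | cons t ht ha _ h ih => exact .cons t ht ha (ih hy) (by linarith)

/-- The starting point may be moved if the steps are long enough to be interrupted at time `T`. -/
theorem move_start {T : τ} (h : SumChain F A e x y) (hT : T ∈ B) (hAB : A ⊆ B)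
    (hA : ∀ t ∈ A, t = T ∨ ∃ s ∈ B, t = s + T) (hx : dist (F T x') (F T x) ≤ r) :
    SumChain F B (r + e) x' y := by
  cases h with
  | single t ht h =>
    rcases hA t ht with rfl | ⟨s, hs, rfl⟩
    · exact .single t hT ((dist_triangle _ _ _).trans (add_le_add hx h))
    · rw [F.map_add] at h
      exact .cons T hT hx (.single s hs h) le_rfl
  | cons t ht ha hc h =>
    rcases hA t ht with rfl | ⟨s, hs, rfl⟩
    · exact .cons t hT ((dist_triangle _ _ _).trans (add_le_add hx ha)) (hc.mono_times hAB)
        (by linarith)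
    · rw [F.map_add] at ha
      exact .cons T hT hx (.cons s hs ha (hc.mono_times hAB) h) le_rfl

theorem prepend_time {s : τ} (h : SumChain F A e (F s x) y) (hA : ∀ t ∈ A, t + s ∈ A) :
    SumChain F A e x y := by
  cases h with
  | single t ht h => exact .single (t + s) (hA t ht) (by rwa [F.map_add])
  | cons t ht ha hc h => exact .cons (t + s) (hA t ht) (by rwa [F.map_add]) hc h

theorem append_time {s : τ} (h : SumChain F A e x y) (hA : ∀ t ∈ A, s + t ∈ A)
    (hy : ∀ w, dist w y ≤ e → dist (F s w) (F s y) ≤ r) :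
    SumChain F A (e + r) x (F s y) := by
  induction h with
  | single t ht h =>
    refine .single (s + t) (hA t ht) ?_
    rw [F.map_add]
    exact (hy _ h).trans (le_add_of_nonneg_left (dist_nonneg.trans h))
  | cons t ht ha _ h ih =>
    refine .cons t ht ha (ih fun w hw => hy w ?_) (by linarith)
    linarith [dist_nonneg.trans ha]

/-- Chains as indexed sequences of points and times. -/
theorem exists_seq (h : SumChain F A e x y) :
    ∃ (n : ℕ) (c : ℕ → X) (t : ℕ → τ), 0 < n ∧ c 0 = x ∧ c n = y ∧ (∀ i < n, t i ∈ A) ∧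
      ∑ i ∈ Finset.range n, dist (F (t i) (c i)) (c (i + 1)) ≤ e := by
  induction h with
  | @single e x y t ht h =>
    exact ⟨1, fun i => if i = 0 then x else y, fun _ => t, one_pos, rfl, rfl, fun _ _ => ht,
      by simpa using h⟩
  | @cons a b e x z y t ht ha _ h ih =>
    obtain ⟨n, c, s, hn, hc0, hcn, hs, hsum⟩ := ih
    refine ⟨n + 1, fun i => Nat.casesOn i x c, fun i => Nat.casesOn i t s, n.succ_pos, rfl, hcn,
      ?_, ?_⟩
    · rintro (_ | i) hi
      · exact ht
      · exact hs i (by lia)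
    · rw [Finset.sum_range_succ']
      subst hc0
      exact (add_le_add hsum ha).trans (by linarith)

end SumChain

theorem isClosed_setOf_forall_sumChain {ι : Type*} (F : Flow τ X) (A : ι → Set τ)
    (hA : ∀ i, ∃ j, A j ⊆ A i ∧ ∃ T ∈ A i, ∀ t ∈ A j, t = T ∨ ∃ s ∈ A i, t = s + T) :
    IsClosed {p : X × X | ∀ i, ∀ ε > 0, SumChain F (A i) ε p.1 p.2} := by
  refine isClosed_of_closure_subset fun p hp i ε hε => ?_
  obtain ⟨j, hji, T, hT, hAT⟩ := hA i
  have hcont : Continuous fun q : X × X => F T q.1 := F.continuous continuous_const continuous_fst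
  have h1 : ∀ᶠ q in 𝓝 p, dist (F T q.1) (F T p.1) < ε / 4 :=
    Metric.tendsto_nhds.1 (hcont.tendsto p) _ (by linarith)
  have h2 : ∀ᶠ q in 𝓝 p, dist q.2 p.2 < ε / 4 :=
    Metric.tendsto_nhds.1 (continuous_snd.tendsto p) _ (by linarith)
  obtain ⟨q, ⟨hq1, hq2⟩, hq⟩ := mem_closure_iff_nhds.1 hp _ (h1.and h2)
  rw [dist_comm] at hq1
  exact (((hq j (ε / 2) (by linarith)).move_start hT hji hAT hq1.le).move_end hq2.le).mono
    (by linarith)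

end SumChain

section Discrete

variable {X : Type*} [MetricSpace X] (F : Flow ℕ X)

theorem sumChain_of_orbit (x : X) (n : ℕ) : SumChain F {1} 0 x (F (n + 1) x) := by
  induction n with
  | zero => exact .single 1 rfl (by simp)
  | succ n ih =>
    have h : SumChain F {1} 0 (F (n + 1) x) (F (n + 1 + 1) x) := by
      refine .single 1 rfl ?_
      rw [add_comm (n + 1) 1, F.map_add 1, dist_self]
    exact (ih.trans h).mono (add_zero 0).le

theorem isStream_forall_sumChain :
    IsStream F {p : X × X | p.1 = p.2 ∨ ∀ ε > 0, SumChain F {1} ε p.1 p.2} where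
  refl _ := Or.inl rfl
  trans := by
    rintro x y z (h : x = y ∨ _) (h' : y = z ∨ _)
    rcases h with rfl | h
    · exact h'
    rcases h' with rfl | h'
    · exact Or.inr h
    exact Or.inr fun ε hε =>
      ((h (ε / 2) (half_pos hε)).trans (h' (ε / 2) (half_pos hε))).mono (add_halves ε).le
  isClosed := by
    have h := isClosed_setOf_forall_sumChain F (fun _ : Unit => {1})
      fun _ => ⟨(), subset_rfl, 1, rfl, fun t ht => Or.inl ht⟩
    simp only [forall_const] at h
    exact (isClosed_eq continuous_fst continuous_snd).union h
  orbitSpace_subset := by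
    rintro ⟨x, y⟩ ⟨_ | n, rfl : F _ x = y⟩
    · exact Or.inl (F.map_zero_apply x).symm
    · exact Or.inr fun ε hε => (sumChain_of_orbit F x n).mono hε.le

theorem auslanderStream_subset_sumChainsStream :
    auslanderStream F ⊆ sumChainsStream F fun x y => dist x y := by
  refine (auslanderStream_subset F (isStream_forall_sumChain F)).trans ?_
  rintro ⟨x, y⟩ (h | h) ε hε
  · exact Or.inl ⟨0, (F.map_zero_apply x).trans h⟩
  · obtain ⟨n, c, t, hn, h0, h1, ht, hsum⟩ := (h (ε / 2) (half_pos hε)).exists_seq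
    refine Or.inr ⟨n, c, hn, h0, h1, lt_of_le_of_lt ?_ (half_lt_self hε)⟩
    refine (Finset.sum_le_sum fun i hi => ?_).trans hsum
    rw [(ht i (Finset.mem_range.1 hi) : t i = 1)]

theorem sumChainsStream_subset_chainsStream :
    sumChainsStream F (fun x y => dist x y) ⊆ chainsStream F fun x y => dist x y := by
  intro p hp ε hε
  refine (hp ε hε).imp_right ?_
  rintro ⟨n, c, hn, h0, h1, h⟩
  exact ⟨n, c, hn, h0, h1, fun i hi => (Finset.single_le_sum
    (f := fun i => dist (F 1 (c i)) (c (i + 1))) (fun _ _ => dist_nonneg)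
    (Finset.mem_range.2 hi)).trans h.le⟩

end Discrete

section Continuous

variable {X : Type*} [MetricSpace X] (F : Flow ℝ≥0 X)

theorem isClosed_setOf_orbit_le (M : ℝ≥0) : IsClosed {p : X × X | ∃ s ≤ M, F s p.1 = p.2} := by
  have : CompactSpace (Iic M) := by
    rw [← isCompact_iff_compactSpace, ← Icc_bot]
    exact isCompact_Icc
  have h : IsClosed {q : Iic M × (X × X) | F q.1 q.2.1 = q.2.2} :=
    isClosed_eq (F.continuous (by fun_prop) (by fun_prop)) (by fun_prop)
  convert isClosedMap_snd_of_compactSpace _ h using 1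
  ext p
  simp only [mem_ofPred_eq, mem_image, Prod.exists, Subtype.exists, mem_Iic]
  constructor
  · rintro ⟨s, hs, h⟩
    exact ⟨s, hs, p.1, p.2, h, rfl⟩
  · rintro ⟨s, hs, x, y, h, rfl⟩
    exact ⟨s, hs, h⟩

/-- An orbit segment of duration at least `2 * T` may be interrupted after time `T`, so limits of
arbitrarily long orbit segments are joined by chains; limits of bounded ones are orbit segments. -/
theorem isStream_orbitSpace_union_sumChain :
    IsStream F (orbitSpace F ∪
      {p : X × X | ∀ T : ℝ≥0, ∀ ε > 0, SumChain F (Ici T) ε p.1 p.2}) where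
  refl x := Or.inl ⟨0, F.map_zero_apply x⟩
  trans := by
    rintro x y z (⟨s, rfl : F s x = y⟩ | h) (⟨s', hz⟩ | h')
    · change F s' (F s x) = z at hz
      subst hz
      exact Or.inl ⟨s' + s, F.map_add s' s x⟩
    · exact Or.inr fun T ε hε => (h' T ε hε).prepend_time fun t ht =>
        le_add_right (mem_Ici.1 ht : T ≤ t)
    · change F s' y = z at hz
      subst hz
      refine Or.inr fun T ε hε => ?_
      have hc : Continuous (F s') := F.continuous continuous_const continuous_id
      obtain ⟨δ, hδ, hδ'⟩ := Metric.continuousAt_iff.1 (hc.continuousAt (x := y)) (ε / 2)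
        (half_pos hε)
      refine ((h T (min (ε / 2) (δ / 2)) (lt_min (half_pos hε) (half_pos hδ))).append_time
        (r := ε / 2) (fun t ht => le_add_left (mem_Ici.1 ht : T ≤ t)) fun w hw => (hδ' ?_).le).mono ?_
      · exact (hw.trans (min_le_right _ _)).trans_lt (half_lt_self hδ)
      · linarith [min_le_left (ε / 2) (δ / 2)]
    · exact Or.inr fun T ε hε =>
        ((h T (ε / 2) (half_pos hε)).trans (h' T (ε / 2) (half_pos hε))).mono (add_halves ε).le
  isClosed := by
    have hD : IsClosed {p : X × X | ∀ T : ℝ≥0, ∀ ε > 0, SumChain F (Ici T) ε p.1 p.2} := by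
      refine isClosed_setOf_forall_sumChain F Ici fun T => ⟨T + T, fun t ht => ?_, T, self_mem_Ici,
        fun t (ht : T + T ≤ t) => Or.inr ⟨t - T, ?_, ?_⟩⟩
      · exact le_self_add.trans (mem_Ici.1 ht)
      · exact le_tsub_of_add_le_right ht
      · exact (tsub_add_cancel_of_le (le_self_add.trans ht)).symm
    refine isClosed_of_closure_subset ?_
    rw [closure_union, hD.closure_eq]
    refine union_subset (fun p hp => ?_) subset_union_right
    by_cases hM : ∃ M : ℝ≥0, p ∈ closure {p : X × X | ∃ s ≤ M, F s p.1 = p.2}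
    · obtain ⟨M, hM⟩ := hM
      rw [(isClosed_setOf_orbit_le F M).closure_eq] at hM
      obtain ⟨s, -, hs⟩ := hM
      exact Or.inl ⟨s, hs⟩
    · push Not at hM
      refine Or.inr fun T ε hε => ?_
      have hsub : orbitSpace F ⊆ {p : X × X | ∃ s ≤ T + T, F s p.1 = p.2} ∪
          {p : X × X | ∃ s, T + T ≤ s ∧ F s p.1 = p.2} := by
        rintro p ⟨s, hs⟩
        rcases le_total s (T + T) with h | h
        · exact Or.inl ⟨s, h, hs⟩
        · exact Or.inr ⟨s, h, hs⟩
      have hp' := closure_mono hsub hp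
      rw [closure_union] at hp'
      have hp'' := hp'.resolve_left (hM _)
      have hcont : Continuous fun q : X × X => F T q.1 :=
        F.continuous continuous_const continuous_fst
      have h1 : ∀ᶠ q in 𝓝 p, dist (F T q.1) (F T p.1) < ε / 2 :=
        Metric.tendsto_nhds.1 (hcont.tendsto p) _ (half_pos hε)
      have h2 : ∀ᶠ q in 𝓝 p, dist q.2 p.2 < ε / 2 :=
        Metric.tendsto_nhds.1 (continuous_snd.tendsto p) _ (half_pos hε)
      obtain ⟨q, ⟨hq1, hq2⟩, s, hs, hq⟩ := mem_closure_iff_nhds.1 hp'' _ (h1.and h2)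
      rw [dist_comm] at hq1
      refine .cons T self_mem_Ici hq1.le (.single (s - T) (le_tsub_of_add_le_right hs) ?_)
        (add_halves ε).le
      rw [← F.map_add, tsub_add_cancel_of_le (le_self_add.trans hs), hq]
      exact hq2.le
  orbitSpace_subset := subset_union_left

theorem auslanderStream_subset_timedSumChainsStream :
    auslanderStream F ⊆ timedSumChainsStream F fun x y => dist x y := by
  refine (auslanderStream_subset F (isStream_orbitSpace_union_sumChain F)).trans ?_
  rintro ⟨x, y⟩ (h | h) T _ ε hε
  · exact Or.inl h
  · obtain ⟨n, c, t, hn, h0, h1, ht, hsum⟩ := (h T (ε / 2) (half_pos hε)).exists_seq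
    exact Or.inr ⟨n, c, t, hn, h0, h1, ht, hsum.trans_lt (half_lt_self hε)⟩

theorem timedSumChainsStream_subset_timedChainsStream :
    timedSumChainsStream F (fun x y => dist x y) ⊆ timedChainsStream F fun x y => dist x y := by
  intro p hp T hT ε hε
  refine (hp T hT ε hε).imp_right ?_
  rintro ⟨n, c, t, hn, h0, h1, ht, h⟩
  exact ⟨n, c, t, hn, h0, h1, fun i hi => ⟨ht i hi, (Finset.single_le_sum
    (f := fun i => dist (F (t i) (c i)) (c (i + 1))) (fun _ _ => dist_nonneg)
    (Finset.mem_range.2 hi)).trans h.le⟩⟩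

end Continuous

/-! ### Chains in discrete time -/

section Discrete

variable {X : Type*}

theorem isArchimedeanUnit_one_nat : IsArchimedeanUnit (1 : ℕ) :=
  fun s => ⟨s, 0, by simp⟩

/-- Short chains with small jumps follow the orbits of points of `G`, if `F 1` is continuous at the
points of these orbits, uniformly in the initial point. -/
theorem exists_forall_dist_chain_lt [MetricSpace X] (F : Flow ℕ X) (G : Set X)
    (hG : ∀ (j : ℕ), ∀ ρ > 0, ∃ δ > 0, ∀ a ∈ G, ∀ w,
      dist w (F j a) < δ → dist (F 1 w) (F 1 (F j a)) < ρ) (J : ℕ) :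
    ∀ ρ > 0, ∃ ε > 0, ∀ c : ℕ → X, c 0 ∈ G → ∀ k ≤ J,
      (∀ i < k, dist (F 1 (c i)) (c (i + 1)) ≤ ε) → dist (c k) (F k (c 0)) < ρ := by
  induction J with
  | zero =>
    intro ρ hρ
    refine ⟨1, one_pos, fun c _ k hk _ => ?_⟩
    obtain rfl : k = 0 := by lia
    rwa [F.map_zero_apply, dist_self]
  | succ J ih =>
    intro ρ hρ
    obtain ⟨δ, hδ, hδG⟩ := hG J (ρ / 2) (half_pos hρ)
    obtain ⟨ε, hε, hεc⟩ := ih (min ρ δ) (lt_min hρ hδ)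
    refine ⟨min ε (ρ / 2), lt_min hε (half_pos hρ), fun c hc k hk hstep => ?_⟩
    rcases hk.lt_or_eq with hk | rfl
    · exact (hεc c hc k (by lia) fun i hi => (hstep i hi).trans (min_le_left _ _)).trans_le
        (min_le_left _ _)
    · have h1 := (hεc c hc J le_rfl fun i hi =>
        (hstep i (by lia)).trans (min_le_left _ _)).trans_le (min_le_right _ _)
      have h2 := hδG _ hc _ h1
      have h3 := (hstep J (by lia)).trans (min_le_right _ _)
      rw [add_comm J 1, F.map_add, add_comm 1 J]
      rw [dist_comm] at h3
      linarith [dist_triangle (c (J + 1)) (F 1 (c J)) (F 1 (F J (c 0)))]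

theorem IsCompactGlobalTrappingRegion.eventually_nhdsSet_forall_mem [TopologicalSpace X]
    {F : Flow ℕ X} {Q : Set X} (hQ : IsCompactGlobalTrappingRegion F Q) {V : Set X}
    (hV : V ∈ 𝓝ˢ Q) : ∀ᶠ a in 𝓝ˢ Q, ∀ t, F t a ∈ V := by
  obtain ⟨W, hW, hWV⟩ := hQ.exists_nhdsSet_mapsTo
  obtain ⟨t₀, ht₀⟩ := hWV V hV
  have h : ∀ᶠ a in 𝓝ˢ Q, ∀ t ∈ Iio t₀, F t a ∈ V :=
    (eventually_all_finite (finite_Iio t₀)).2 fun t _ =>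
      (F.continuous continuous_const continuous_id).tendsto_nhdsSet
        (hQ.isTrappingRegion.2 t) |>.eventually hV
  filter_upwards [h, hW] with a ha haW t
  rcases lt_or_ge t t₀ with ht | ht
  · exact ha t ht
  · exact ht₀ t ht haW

/-- Chains with small jumps that start near `Q` stay near `Q`: after a fixed number of steps the
orbit that a chain follows has come closer to `Q` than its initial point, which makes up for the
jumps. -/
theorem IsCompactGlobalTrappingRegion.exists_forall_chain_mem_thickening [MetricSpace X]
    {F : Flow ℕ X} {Q : Set X} (hQ : IsCompactGlobalTrappingRegion F Q)
    (huc : UniformlyContinuousNear (fun x y => dist x y) (F 1) Q) {r : ℝ} (hr : 0 < r) :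
    ∃ δ > 0, ∃ ε > 0, ∀ (n : ℕ) (c : ℕ → X), c 0 ∈ Metric.thickening δ Q →
      (∀ i < n, dist (F 1 (c i)) (c (i + 1)) ≤ ε) → ∀ i ≤ n, c i ∈ Metric.thickening r Q := by
  have hb := Metric.hasBasis_nhdsSet_thickening hQ.isCompact
  obtain ⟨U, hU, hUuc⟩ := huc
  obtain ⟨η, hη, hηU⟩ := hb.mem_iff.1 hU
  obtain ⟨W, hW, hWV⟩ := hQ.exists_nhdsSet_mapsTo
  -- Orbits from the `δ`-neighbourhood stay within half of `min r η` of `Q`; the other half is left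
  -- for the distance between the chain and the orbit that it follows.
  have hη' : 0 < min r η / 2 := half_pos (lt_min hr hη)
  obtain ⟨δ, hδ, hδQ⟩ := hb.mem_iff.1 ((hQ.eventually_nhdsSet_forall_mem
    (hb.mem_of_mem hη')).and hW)
  obtain ⟨t₁, ht₁⟩ := hWV _ (hb.mem_of_mem (half_pos hδ))
  have hthick : ∀ {α β : ℝ} {v w : X}, v ∈ Metric.thickening α Q → dist w v < β →
      w ∈ Metric.thickening (α + β) Q := fun {α β v w} hv hw => by
    obtain ⟨q, hq, hvq⟩ := Metric.mem_thickening_iff.1 hv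
    exact Metric.mem_thickening_iff.2 ⟨q, hq, by linarith [dist_triangle w v q]⟩
  obtain ⟨ε, hε, hεc⟩ := exists_forall_dist_chain_lt F (Metric.thickening δ Q) (by
    intro j ρ hρ
    obtain ⟨κ, hκ, hκU⟩ := hUuc ρ hρ
    refine ⟨min κ (min r η / 2), lt_min hκ hη', fun a ha w hw => ?_⟩
    have h1 := (hδQ ha).1 j
    refine hκU w (hηU ?_) _ (hηU ?_) (hw.trans_le (min_le_left _ _))
    · refine Metric.thickening_mono ?_ _ (hthick h1 (hw.trans_le (min_le_right _ _)))
      linarith [min_le_right r η]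
    · refine Metric.thickening_mono ?_ _ h1
      linarith [min_le_right r η]) (max t₁ 1) (min (δ / 2) (min r η / 2))
    (lt_min (half_pos hδ) hη')
  refine ⟨δ, hδ, ε, hε, fun n => ?_⟩
  induction n using Nat.strong_induction_on with
  | _ n ih =>
    intro c hc hstep i hi
    rcases le_or_gt i (max t₁ 1) with hit | hit
    · have h := hεc c hc i hit fun k hk => hstep k (by lia)
      refine Metric.thickening_mono ?_ _
        (hthick ((hδQ hc).1 i) (h.trans_le (min_le_right _ _)))
      linarith [min_le_left r η]
    · set t₀ := max t₁ 1 with ht₀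
      have h1 : 1 ≤ t₀ := le_max_right _ _
      have h := hεc c hc t₀ le_rfl fun k hk => hstep k (by lia)
      have hF := ht₁ t₀ (le_max_left _ _) (hδQ hc).2
      have hc' : c t₀ ∈ Metric.thickening δ Q :=
        Metric.thickening_mono (add_halves δ).le _ (hthick hF (h.trans_le (min_le_left _ _)))
      have := ih (n - t₀) (by lia) (fun k => c (k + t₀)) (by simpa using hc')
        (fun k hk => by
          have := hstep (k + t₀) (by lia)
          rwa [show k + t₀ + 1 = k + 1 + t₀ by lia] at this) (i - t₀) (by lia)
      rwa [Nat.sub_add_cancel hit.le] at this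

theorem chainsStream_dist_subset_auslanderStream [MetricSpace X] {F : Flow ℕ X} {Q : Set X}
    (hQ : IsCompactGlobalTrappingRegion F Q) (hnodes : (nodes F (auslanderStream F)).Countable)
    (huc : UniformlyContinuousNear (fun x y => dist x y) (F 1) Q) :
    chainsStream F (fun x y => dist x y) ⊆ auslanderStream F := by
  rintro ⟨x, y⟩ hxy
  have hA := isStream_auslanderStream F
  by_cases horb : (x, y) ∈ orbitSpace F
  · exact hA.orbitSpace_subset horb
  obtain ⟨⟨p, hpx⟩, hpQ⟩ := hQ.isGloballyAttracting x
  refine hA.trans _ _ _ (hA.mem_of_mem_omegaLimit hpx) ?_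
  refine mem_of_chains_near hA hnodes isArchimedeanUnit_one_nat hQ.isCompact (hpQ hpx) ?_
  intro r hr U hU hpU
  obtain ⟨δ, hδ, ε₁, hε₁, hstay⟩ := hQ.exists_forall_chain_mem_thickening huc hr
  have hVo : IsOpen (U ∩ Metric.thickening δ Q) := hU.inter Metric.isOpen_thickening
  have hcluster := (mem_omegaLimit_singleton_iff_mapClusterPt _ _ _ _).1 hpx
  obtain ⟨J, hJ⟩ := (hcluster.frequently (hVo.mem_nhds
    ⟨hpU, Metric.self_subset_thickening hδ Q (hpQ hpx)⟩)).exists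
  obtain ⟨ρ, hρ, hρV⟩ := Metric.isOpen_iff.1 hVo _ hJ
  -- A chain that follows the orbit of `x` for `J` steps cannot meet `y` during these steps.
  have hfin : ((fun j => F j x) '' Iic J).Finite := (finite_Iic J).image _
  obtain ⟨σ, hσ, hσy⟩ := Metric.isOpen_iff.1 hfin.isClosed.isOpen_compl y (by
    rintro ⟨j, -, hj⟩
    exact horb ⟨j, hj⟩)
  obtain ⟨ε₂, hε₂, hfollow⟩ := exists_forall_dist_chain_lt F {x} (by
    intro j κ hκ
    have hc : Continuous (F 1) := F.continuous continuous_const continuous_id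
    obtain ⟨δ', hδ', h⟩ := Metric.continuousAt_iff.1 (hc.continuousAt (x := F j x)) κ hκ
    refine ⟨δ', hδ', ?_⟩
    rintro a rfl w hw
    exact h hw) J (min ρ σ) (lt_min hρ hσ)
  obtain ⟨n, c, hn, rfl, rfl, hstep⟩ := (hxy (min (r / 2) (min ε₁ ε₂))
    (lt_min (half_pos hr) (lt_min hε₁ hε₂))).resolve_left horb
  dsimp only at *
  have hs1 : ∀ i < n, dist (F 1 (c i)) (c (i + 1)) ≤ ε₁ := fun i hi =>
    (hstep i hi).trans ((min_le_right _ _).trans (min_le_left _ _))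
  have hs2 : ∀ i < n, dist (F 1 (c i)) (c (i + 1)) ≤ ε₂ := fun i hi =>
    (hstep i hi).trans ((min_le_right _ _).trans (min_le_right _ _))
  have hJn : J < n := by
    by_contra! hnJ
    have h := (hfollow c rfl n hnJ hs2).trans_le (min_le_right _ _)
    rw [dist_comm] at h
    exact hσy h ⟨n, hnJ, rfl⟩
  have hcJ := hρV ((hfollow c rfl J le_rfl fun i hi => hs2 i (by lia)).trans_le (min_le_left _ _))
  have hshift : ∀ k, c (k + J + 1) = c (k + 1 + J) := fun k => by rw [add_right_comm]
  refine ⟨n - J, fun i => c (i + J), fun _ => 0, ?_, ?_, ?_, fun i hi => ?_⟩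
  · simpa using hcJ.1
  · simp only [Nat.sub_add_cancel hJn.le]
  · refine hstay (n - J) _ (by simpa using hcJ.2) fun i hi => ?_
    have := hs1 (i + J) (by lia)
    rwa [hshift] at this
  · have := (hstep (i + J) (by lia)).trans (min_le_left _ _)
    rw [hshift] at this
    rw [zero_add]
    exact this.trans_lt (half_lt_self hr)

/-! ### A compatible metric for which the time-one map is Lipschitz -/

/-- The metric is `∑ n, 2⁻ⁿ * min 1 (dist (F n x) (F n y))`. -/
theorem exists_isCompatibleMetric_lipschitz [TopologicalSpace X] [MetrizableSpace X]
    (F : Flow ℕ X) :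
    ∃ d : X → X → ℝ, IsCompatibleMetric d ∧ ∀ x y, d (F 1 x) (F 1 y) ≤ 2 * d x y := by
  let _ := metrizableSpaceMetric X
  let m : ℕ → X → X → ℝ := fun n x y => (1 / 2 : ℝ) ^ n * min 1 (dist (F n x) (F n y))
  have hm0 : ∀ n x y, 0 ≤ m n x y := fun n x y =>
    mul_nonneg (by positivity) (le_min zero_le_one dist_nonneg)
  have hm1 : ∀ n x y, m n x y ≤ (1 / 2 : ℝ) ^ n := fun n x y =>
    mul_le_of_le_one_right (by positivity) (min_le_left _ _)
  have hgeom : Summable fun n : ℕ => (1 / 2 : ℝ) ^ n := summable_geometric_two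
  have hsum : ∀ x y, Summable fun n => m n x y := fun x y =>
    hgeom.of_nonneg_of_le (fun n => hm0 n x y) fun n => hm1 n x y
  have hFc : ∀ n, Continuous (F n) := fun n => F.continuous continuous_const continuous_id
  have hself : ∀ x, ∑' n, m n x x = 0 := fun x => by simp [m]
  have hdist : ∀ x y, min 1 (dist x y) ≤ ∑' n, m n x y := fun x y => by
    have h := (hsum x y).le_tsum 0 fun n _ => hm0 n x y
    simpa only [m, pow_zero, one_mul, F.map_zero_apply] using h
  refine ⟨fun x y => ∑' n, m n x y, ⟨hself, fun x y h => ?_, fun x y => ?_, fun x y z => ?_,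
    fun s => ?_⟩, fun x y => ?_⟩
  · by_contra hne
    have := lt_min one_pos (dist_pos.2 hne)
    linarith [hdist x y]
  · simp only [m, dist_comm]
  · rw [← (hsum x y).tsum_add (hsum y z)]
    refine (hsum x z).tsum_le_tsum (fun n => ?_) ((hsum x y).add (hsum y z))
    rw [← mul_add]
    refine mul_le_mul_of_nonneg_left ?_ (by positivity)
    have := dist_triangle (F n x) (F n y) (F n z)
    rcases le_total 1 (dist (F n x) (F n y)) with h | h
    · rw [min_eq_left h]
      exact (min_le_left _ _).trans (le_add_of_nonneg_right (le_min zero_le_one dist_nonneg))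
    rcases le_total 1 (dist (F n y) (F n z)) with h' | h'
    · rw [min_eq_left h']
      exact (min_le_left _ _).trans (le_add_of_nonneg_left (le_min zero_le_one dist_nonneg))
    rw [min_eq_right h, min_eq_right h']
    exact (min_le_right _ _).trans this
  · constructor
    · intro hs x hx
      obtain ⟨ε, hε, hεs⟩ := Metric.isOpen_iff.1 hs x hx
      refine ⟨min 1 ε, lt_min one_pos hε, fun y hy => hεs ?_⟩
      have h := (hdist x y).trans_lt hy
      rw [Metric.mem_ball, dist_comm]
      by_contra! hle
      exact (min_le_min_left 1 hle).not_gt h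
    · intro hs
      refine isOpen_iff_mem_nhds.2 fun x hx => ?_
      obtain ⟨ε, hε, hεs⟩ := hs x hx
      have hc : Continuous fun y => ∑' n, m n x y :=
        continuous_tsum (fun n => by have := hFc n; fun_prop) hgeom fun n y => by
          rw [Real.norm_of_nonneg (hm0 n x y)]
          exact hm1 n x y
      filter_upwards [(hc.tendsto x).eventually_lt_const (by rwa [hself x])] with y hy
      exact hεs y hy
  · have h := (hsum x y).tsum_eq_zero_add
    have h' : ∑' n, m (n + 1) x y = (1 / 2) * ∑' n, m n (F 1 x) (F 1 y) := by
      rw [← tsum_mul_left]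
      refine tsum_congr fun n => ?_
      simp only [m, F.map_add]
      ring
    dsimp only
    linarith [hm0 0 x y]

end Discrete

/-! ### Chains in continuous time -/

section Continuous

variable {X : Type*} [MetricSpace X]

theorem isArchimedeanUnit_one_nnreal : IsArchimedeanUnit (1 : ℝ≥0) := fun s => by
  obtain ⟨n, hn⟩ := exists_nat_ge s
  exact ⟨n, n - s, by rw [tsub_add_cancel_of_le hn, nsmul_one]⟩

theorem timedChainsStream_dist_subset_auslanderStream {F : Flow ℝ≥0 X} {Q : Set X}
    (hQ : IsCompactGlobalTrappingRegion F Q)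
    (hnodes : (nodes F (auslanderStream F)).Countable) :
    timedChainsStream F (fun x y => dist x y) ⊆ auslanderStream F := by
  rintro ⟨x, y⟩ hxy
  have hA := isStream_auslanderStream F
  by_cases horb : (x, y) ∈ orbitSpace F
  · exact hA.orbitSpace_subset horb
  obtain ⟨⟨p, hpx⟩, hpQ⟩ := hQ.isGloballyAttracting x
  refine hA.trans _ _ _ (hA.mem_of_mem_omegaLimit hpx) ?_
  refine mem_of_chains_near hA hnodes isArchimedeanUnit_one_nnreal hQ.isCompact (hpQ hpx) ?_
  intro r hr U hU hpU
  have hb := Metric.hasBasis_nhdsSet_thickening hQ.isCompact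
  obtain ⟨W, hW, hWV⟩ := hQ.exists_nhdsSet_mapsTo
  obtain ⟨η, hη, hηW⟩ := hb.mem_iff.1 hW
  obtain ⟨δ, hδ, hδr, hδη⟩ : ∃ δ > 0, δ ≤ r ∧ δ ≤ η :=
    ⟨min r η, lt_min hr hη, min_le_left _ _, min_le_right _ _⟩
  obtain ⟨T₀, hT₀⟩ := hWV _ (hb.mem_of_mem (half_pos hδ))
  have hVo : IsOpen (U ∩ Metric.thickening δ Q) := hU.inter Metric.isOpen_thickening
  have hcluster := (mem_omegaLimit_singleton_iff_mapClusterPt _ _ _ _).1 hpx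
  obtain ⟨s, hsU, hsQ⟩ := (hcluster.frequently (hVo.mem_nhds
    ⟨hpU, Metric.self_subset_thickening hδ Q (hpQ hpx)⟩)).exists
  obtain ⟨n, c, t, hn, rfl, rfl, hstep⟩ := (hxy (s + (T₀ + 1)) (by positivity) (δ / 2)
    (half_pos hδ)).resolve_left horb
  -- The first step is long enough to be started at the point `F s (c 0)` close to `p` instead.
  obtain ⟨c', hc'0, hc'⟩ : ∃ c' : ℕ → X, c' 0 = F s (c 0) ∧ ∀ i, c' (i + 1) = c (i + 1) :=
    ⟨fun i => Nat.casesOn i (F s (c 0)) fun i => c (i + 1), rfl, fun _ => rfl⟩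
  have hstep' : ∀ i, ∃ t' : ℝ≥0, i < n →
      T₀ ≤ t' + 1 ∧ dist (F (t' + 1) (c' i)) (c' (i + 1)) ≤ δ / 2 := by
    rintro (_ | i)
    · refine ⟨t 0 - s - 1, fun hi => ?_⟩
      obtain ⟨ht, hd⟩ := hstep 0 hi
      have h1 : T₀ + 1 ≤ t 0 - s := le_tsub_of_add_le_left ht
      rw [tsub_add_cancel_of_le (le_add_self.trans h1), hc'0, hc', ← F.map_add,
        tsub_add_cancel_of_le (le_self_add.trans ht)]
      exact ⟨le_self_add.trans h1, hd⟩
    · refine ⟨t (i + 1) - 1, fun hi => ?_⟩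
      obtain ⟨ht, hd⟩ := hstep (i + 1) hi
      have h1 : T₀ + 1 ≤ t (i + 1) := le_add_self.trans ht
      rw [tsub_add_cancel_of_le (le_add_self.trans h1), hc', hc']
      exact ⟨le_self_add.trans h1, hd⟩
  choose t' ht' using hstep'
  have hnear : ∀ i ≤ n, c' i ∈ Metric.thickening δ Q := by
    intro i
    induction i with
    | zero => exact fun _ => hc'0 ▸ hsQ
    | succ i ih =>
      intro hi
      obtain ⟨h1, h2⟩ := ht' i hi
      have h3 := hT₀ _ h1 (hηW (Metric.thickening_mono hδη _ (ih (by lia))))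
      obtain ⟨q, hq, hqd⟩ := Metric.mem_thickening_iff.1 h3
      rw [dist_comm] at h2
      exact Metric.mem_thickening_iff.2 ⟨q, hq, by
        linarith [dist_triangle (c' (i + 1)) (F (t' i + 1) (c' i)) q]⟩
  refine ⟨n, c', t', hc'0 ▸ hsU, ?_, fun i hi => Metric.thickening_mono hδr _ (hnear i hi),
    fun i hi => (ht' i hi).2.trans_lt (by linarith)⟩
  obtain ⟨k, rfl⟩ : ∃ k, n = k + 1 := ⟨n - 1, by lia⟩
  exact hc' k

end Continuous

/-! ### Arbitrary compatible metrics -/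

section Compatible

variable {X : Type*} [TopologicalSpace X] {d : X → X → ℝ}

theorem IsCompatibleMetric.auslanderStream_subset_sumChainsStream (hd : IsCompatibleMetric d)
    (F : Flow ℕ X) : auslanderStream F ⊆ sumChainsStream F d := by
  obtain ⟨m, rfl, rfl⟩ := hd.exists_metricSpace
  exact ChainStreams.auslanderStream_subset_sumChainsStream F

theorem IsCompatibleMetric.sumChainsStream_subset_chainsStream (hd : IsCompatibleMetric d)
    (F : Flow ℕ X) : sumChainsStream F d ⊆ chainsStream F d := by
  obtain ⟨m, rfl, rfl⟩ := hd.exists_metricSpace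
  exact ChainStreams.sumChainsStream_subset_chainsStream F

theorem IsCompatibleMetric.chainsStream_subset_auslanderStream (hd : IsCompatibleMetric d)
    {F : Flow ℕ X} {Q : Set X} (hQ : IsCompactGlobalTrappingRegion F Q)
    (hnodes : (nodes F (auslanderStream F)).Countable)
    (huc : UniformlyContinuousNear d (F 1) Q) : chainsStream F d ⊆ auslanderStream F := by
  obtain ⟨m, rfl, rfl⟩ := hd.exists_metricSpace
  exact chainsStream_dist_subset_auslanderStream hQ hnodes huc

theorem IsCompatibleMetric.auslanderStream_subset_timedSumChainsStream
    (hd : IsCompatibleMetric d) (F : Flow ℝ≥0 X) :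
    auslanderStream F ⊆ timedSumChainsStream F d := by
  obtain ⟨m, rfl, rfl⟩ := hd.exists_metricSpace
  exact ChainStreams.auslanderStream_subset_timedSumChainsStream F

theorem IsCompatibleMetric.timedSumChainsStream_subset_timedChainsStream
    (hd : IsCompatibleMetric d) (F : Flow ℝ≥0 X) :
    timedSumChainsStream F d ⊆ timedChainsStream F d := by
  obtain ⟨m, rfl, rfl⟩ := hd.exists_metricSpace
  exact ChainStreams.timedSumChainsStream_subset_timedChainsStream F

theorem IsCompatibleMetric.timedChainsStream_subset_auslanderStream (hd : IsCompatibleMetric d)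
    {F : Flow ℝ≥0 X} {Q : Set X} (hQ : IsCompactGlobalTrappingRegion F Q)
    (hnodes : (nodes F (auslanderStream F)).Countable) :
    timedChainsStream F d ⊆ auslanderStream F := by
  obtain ⟨m, rfl, rfl⟩ := hd.exists_metricSpace
  exact timedChainsStream_dist_subset_auslanderStream hQ hnodes

end Compatible

end ChainStreams

/-! ### Auslander's stream and chains streams -/

theorem mainTheorem5 {X : Type*} [TopologicalSpace X] [MetrizableSpace X] [ConnectedSpace X] :
    -- discrete time
    (∀ (F : Flow ℕ X) (Q : Set X), IsCompactGlobalTrappingRegion F Q →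
      (nodes F (auslanderStream F)).Countable →
      (∀ d : X → X → ℝ, IsCompatibleMetric d →
        UniformlyContinuousNear d (F 1) Q →
        auslanderStream F = chainsStream F d ∧
        sumChainsStream F d = chainsStream F d ∧
        ∀ S : Set (X × X), IsStream F S →
          auslanderStream F ⊆ S → S ⊆ chainsStream F d →
          S = chainsStream F d ∧
          nodes F S = nodes F (auslanderStream F) ∧
          nodes F S = nodes F (chainsStream F d) ∧
          edges F S = edges F (auslanderStream F) ∧
          edges F S = edges F (chainsStream F d)) ∧
      auslanderStream F =
        ⋂ d ∈ {d : X → X → ℝ | IsCompatibleMetric d},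
          chainsStream F d) ∧
    -- continuous time
    (∀ (F : Flow ℝ≥0 X) (Q : Set X), IsCompactGlobalTrappingRegion F Q →
      (nodes F (auslanderStream F)).Countable →
      ∀ d : X → X → ℝ, IsCompatibleMetric d →
        auslanderStream F = timedChainsStream F d ∧
        timedSumChainsStream F d = timedChainsStream F d ∧
        ∀ S : Set (X × X), IsStream F S →
          auslanderStream F ⊆ S → S ⊆ timedChainsStream F d →
          S = timedChainsStream F d ∧
          nodes F S = nodes F (auslanderStream F) ∧
          nodes F S = nodes F (timedChainsStream F d) ∧
          edges F S = edges F (auslanderStream F) ∧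
          edges F S = edges F (timedChainsStream F d)) := by
  refine ⟨fun F Q hQ hnodes => ⟨fun d hd huc => ?_, ?_⟩, fun F Q hQ hnodes d hd => ?_⟩
  · have h1 := hd.auslanderStream_subset_sumChainsStream F
    have h2 := hd.sumChainsStream_subset_chainsStream F
    have h3 := hd.chainsStream_subset_auslanderStream hQ hnodes huc
    have hAC : auslanderStream F = chainsStream F d := (h1.trans h2).antisymm h3
    refine ⟨hAC, h2.antisymm (h3.trans h1), fun S _ hAS hSC => ?_⟩
    obtain rfl : S = chainsStream F d := hSC.antisymm (h3.trans hAS)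
    rw [hAC]
    exact ⟨rfl, rfl, rfl, rfl, rfl⟩
  · refine (subset_iInter₂ fun d hd => ?_).antisymm ?_
    · exact (IsCompatibleMetric.auslanderStream_subset_sumChainsStream hd F).trans
        (IsCompatibleMetric.sumChainsStream_subset_chainsStream hd F)
    · obtain ⟨d, hd, hlip⟩ := exists_isCompatibleMetric_lipschitz F
      refine (biInter_subset_of_mem hd).trans (hd.chainsStream_subset_auslanderStream hQ hnodes
        ⟨univ, univ_mem, fun ε hε => ⟨ε / 2, half_pos hε, fun x _ y _ hxy => ?_⟩⟩)
      linarith [hlip x y]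
  · have h1 := hd.auslanderStream_subset_timedSumChainsStream F
    have h2 := hd.timedSumChainsStream_subset_timedChainsStream F
    have h3 := hd.timedChainsStream_subset_auslanderStream hQ hnodes
    have hAC : auslanderStream F = timedChainsStream F d := (h1.trans h2).antisymm h3
    refine ⟨hAC, h2.antisymm (h3.trans h1), fun S _ hAS hSC => ?_⟩
    obtain rfl : S = timedChainsStream F d := hSC.antisymm (h3.trans hAS)
    rw [hAC]
    exact ⟨rfl, rfl, rfl, rfl, rfl⟩
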